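/- A Cantor set is a topological space homeomorphic to the standard middle-thirds Cantor set. For a metric space $X$ let $\mathcal C(X)$ denote the set of all Cantor sets $K\subset X$, endowed with the Hausdorff metric. Let $\ell_2$ be the real Hilbert space of square-summable sequences. Let $X$ be $\mathbb R^N$ (with the Euclidean inner product) or $\ell_2$, let $H$ be a non-zero proper finite-dimensional linear subspace of $X$, put $k=\dim H$, and let $p_H:X\to H^\perp$ be the orthogonal projection onto $H^\perp$. For a non-empty set $M\subset X$, the fibers of $p_H|_M$ are the sets $\{B\in M : p_H(B)=p_H(A)\}$ with $A\in M$; a fiber is non-degenerate if it has more than one point. The set $M$ is in general position with respect to $H$ if 1. $p_H|_M$ has only finitely many non-degenerate fibers; 2. each non-degenerate fiber has at most $k+1$ points, and these points are affinely independent (that is, a non-degenerate fiber $F$ is the vertex set of a simplex of dimension $|F|-1$); 3. $\sum_F (|F|-1)\le k$, where the sum is over the distinct non-degenerate fibers $F$ of $p_H|_M$. A set $M\subset\mathbb R^N$ is in general position with respect to all projections if it is in general position with respect to every non-zero proper linear subspace $H\subset\mathbb R^N$. A set $M\subset\ell_2$ is in general position with respect to all projections with finite-dimensional kernels if it is in general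 position with respect to every non-zero finite-dimensional linear subspace $H\subset\ell_2$. Theorem. For every integer $N\ge 2$, the Cantor sets in $\mathbb R^N$ that are in general position with respect to all projections form a dense $G_\delta$ subset of $\mathcal C(\mathbb R^N)$. The Cantor sets in $\ell_2$ that are in general position with respect to all projections with finite-dimensional kernels form a dense $G_\delta$ subset of $\mathcal C(\ell_2)$. -/

import Mathlib

noncomputable section

open TopologicalSpace

/-- A Cantor set is a space homeomorphic to the standard middle-thirds Cantor set. -/
def IsCantorSet {E : Type*} [TopologicalSpace E] (S : Set E) : Prop :=
  Nonempty (S ≃ₜ cantorSet)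

/-- The hyperspace of all Cantor sets in `E`, a subspace of the space of non-empty compact
subsets of `E` with the Hausdorff metric. -/
abbrev CantorHyperspace (E : Type*) [MetricSpace E] : Type _ :=
  {K : NonemptyCompacts E // IsCantorSet (K : Set E)}

variable {E : Type*} [NormedAddCommGroup E] [InnerProductSpace ℝ E]

/-- The fiber through `A` of the restriction to `M` of the orthogonal projection
`p_H : E → Hᗮ` with kernel `H`. -/
def projFiber (H : Submodule ℝ E) [FiniteDimensional ℝ H] (M : Set E) (A : E) : Set E :=
  {B ∈ M | Hᗮ.orthogonalProjectionOnto B = Hᗮ.orthogonalProjectionOnto A}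

/-- The collection of the fibers of `p_H|_M` with more than one point. -/
def nondegenerateFibers (H : Submodule ℝ E) [FiniteDimensional ℝ H] (M : Set E) :
    Set (Set E) :=
  {F | (∃ A ∈ M, F = projFiber H M A) ∧ 1 < F.encard}

/-- `M` is in general position with respect to the orthogonal projection with
finite-dimensional kernel `H`. The sum in `excess_le` runs over the distinct
non-degenerate fibers; they are finite sets by `encard_le`. -/
structure InGeneralPositionWrt (H : Submodule ℝ E) [FiniteDimensional ℝ H] (M : Set E) :
    Prop where
  finite_fibers : (nondegenerateFibers H M).Finite
  encard_le : ∀ F ∈ nondegenerateFibers H M, F.encard ≤ (Module.finrank ℝ H + 1 : ℕ)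
  affineIndependent : ∀ F ∈ nondegenerateFibers H M,
    AffineIndependent ℝ (fun x : F => (x : E))
  excess_le : ∑ F ∈ finite_fibers.toFinset, (F.ncard - 1) ≤ Module.finrank ℝ H

/-- `M` is in general position with respect to all projections whose kernel is a non-zero
proper subspace; every subspace of a finite-dimensional `E` is finite-dimensional. -/
def InGeneralPositionWrtAll [FiniteDimensional ℝ E] (M : Set E) : Prop :=
  ∀ H : Submodule ℝ E, H ≠ ⊥ → H ≠ ⊤ → InGeneralPositionWrt H M

/-- `M` is in general position with respect to all projections whose kernel is a non-zero
proper finite-dimensional subspace. -/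
def InGeneralPositionWrtFiniteKernels (M : Set E) : Prop :=
  ∀ (H : Submodule ℝ E) [FiniteDimensional ℝ H], H ≠ ⊥ → H ≠ ⊤ → InGeneralPositionWrt H M

end

open TopologicalSpace

/-! General position with respect to all kernels at once amounts to one linear condition on `M`,
`StarIndependent`. Choose a root in each fiber of `p_H|_M`. Each other point minus its root lies in
`H`, so independence of these differences allows at most `k` non-root points, which is the bound on
the excess sum. Conversely, `m` dependent differences span a kernel of dimension below `m` whose
fibers have excess at least `m`. Independence is an open condition on tuples, so compactness makes
`StarIndependent` a countable intersection of open conditions on `K`. For density, parametrize a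
Cantor set by binary sequences. Locally constant maps take finitely many values, which can be
perturbed into general position; Baire's theorem in `C(ℕ → Bool, E)` then handles all tuples
simultaneously. -/

/-- The entries of `a` are pairwise `R`-related, and each of them is `R`-related to every entry
of `b`. -/
def Separated {α ι : Type*} (R : α → α → Prop) (a b : ι → α) : Prop :=
  (∀ i j, i ≠ j → R (a i) (a j)) ∧ ∀ i j, R (a i) (b j)

/-- The differences `a i - b i` of points of `M` are linearly independent whenever the `a i` are
distinct, differ from all `b j`, and are at most as many as the dimension allows. -/
def StarIndependent {E : Type*} [AddCommGroup E] [Module ℝ E] (M : Set E) : Prop :=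
  ∀ m : ℕ, (m : Cardinal) ≤ Module.rank ℝ E → ∀ a b : Fin m → E,
    (∀ i, a i ∈ M) → (∀ i, b i ∈ M) → Separated (· ≠ ·) a b →
      LinearIndependent ℝ fun i => a i - b i

/-! ### General position as linear independence of differences -/

section Equivalence

variable {E : Type*} [NormedAddCommGroup E] [InnerProductSpace ℝ E]

theorem mem_projFiber_iff {H : Submodule ℝ E} [FiniteDimensional ℝ H] {M : Set E} {A B : E} :
    B ∈ projFiber H M A ↔ B ∈ M ∧ B - A ∈ H := by
  rw [projFiber, Set.mem_ofPred_eq, ← sub_eq_zero, ← map_sub,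
    Submodule.orthogonalProjectionOnto_eq_zero_iff, Submodule.orthogonal_orthogonal]

theorem projFiber_eq_of_sub_mem {H : Submodule ℝ E} [FiniteDimensional ℝ H] {M : Set E} {A B : E}
    (h : B - A ∈ H) : projFiber H M B = projFiber H M A := by
  ext C
  rw [mem_projFiber_iff, mem_projFiber_iff]
  refine and_congr_right fun _ => ⟨fun hC => ?_, fun hC => ?_⟩
  · simpa using H.add_mem hC h
  · simpa using H.sub_mem hC h

theorem Submodule.finrank_add_one_le_rank {H : Submodule ℝ E} [FiniteDimensional ℝ H]
    (hH : H ≠ ⊤) : ((Module.finrank ℝ H + 1 : ℕ) : Cardinal) ≤ Module.rank ℝ E := by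
  by_contra! h
  have hfin : FiniteDimensional ℝ E :=
    Module.rank_lt_aleph0_iff.1 (h.trans (Cardinal.natCast_lt_aleph0))
  rw [← Module.finrank_eq_rank, Nat.cast_lt, Nat.lt_succ_iff] at h
  exact hH (Submodule.eq_top_of_finrank_eq (le_antisymm H.finrank_le h))

namespace StarIndependent

variable {M : Set E}

/-- The values of `ρ` may coincide, as they do for points of one fiber sharing a root; `Separated`
leaves the `b i` free to repeat for this reason. -/
theorem linearIndependent_finset (hM : StarIndependent M) {A : Finset E} {ρ : E → E}
    (hA : ↑A ⊆ M) (hρ : ∀ a ∈ A, ρ a ∈ M) (hne : ∀ a ∈ A, ∀ b ∈ A, a ≠ ρ b)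
    (hcard : (A.card : Cardinal) ≤ Module.rank ℝ E) :
    LinearIndependent ℝ fun a : A => (a : E) - ρ a := by
  have h := hM A.card hcard (fun i => A.equivFin.symm i) (fun i => ρ (A.equivFin.symm i))
    (fun i => hA (A.equivFin.symm i).2) (fun i => hρ _ (A.equivFin.symm i).2)
    ⟨fun i j hij h => hij (A.equivFin.symm.injective (Subtype.ext h)),
      fun i j => hne _ (A.equivFin.symm i).2 _ (A.equivFin.symm j).2⟩
  exact (linearIndependent_equiv A.equivFin.symm (f := fun a : A => (a : E) - ρ a)).1 h

/-- Otherwise `finrank H + 1` of the differences would be independent inside `H`; properness of `H`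
keeps that number within the rank of `E`. -/
theorem card_le_finrank (hM : StarIndependent M) {H : Submodule ℝ E} [FiniteDimensional ℝ H]
    (hH : H ≠ ⊤) {A : Finset E} {ρ : E → E} (hA : ↑A ⊆ M) (hρ : ∀ a ∈ A, ρ a ∈ M)
    (hne : ∀ a ∈ A, ∀ b ∈ A, a ≠ ρ b) (hsub : ∀ a ∈ A, a - ρ a ∈ H) :
    A.card ≤ Module.finrank ℝ H := by
  by_contra! hlt
  obtain ⟨B, hBA, hB⟩ := Finset.exists_subset_card_eq (Nat.succ_le_of_lt hlt)
  have hli := hM.linearIndependent_finset (A := B) (ρ := ρ)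
    ((Finset.coe_subset.2 hBA).trans hA) (fun a ha => hρ a (hBA ha))
    (fun a ha b hb => hne a (hBA ha) b (hBA hb))
    (by rw [hB]; exact Submodule.finrank_add_one_le_rank hH)
  have hli' : LinearIndependent ℝ fun a : B => (⟨a - ρ a, hsub a (hBA a.2)⟩ : H) :=
    LinearIndependent.of_comp H.subtype hli
  have := hli'.fintype_card_le_finrank
  rw [Fintype.card_coe, hB] at this
  omega

theorem inGeneralPositionWrt (hM : StarIndependent M) (H : Submodule ℝ E)
    [FiniteDimensional ℝ H] (hH : H ≠ ⊤) : InGeneralPositionWrt H M := by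
  classical
  -- `ρ` chooses a point in each fiber, and `S` collects the points that are not chosen.
  obtain ⟨ρ, hρM, hρH, hρ⟩ : ∃ ρ : E → E, (∀ a ∈ M, ρ a ∈ M) ∧ (∀ a ∈ M, a - ρ a ∈ H) ∧
      ∀ a b, projFiber H M a = projFiber H M b → ρ a = ρ b := by
    let c : Set E → E := fun F => if h : F.Nonempty then h.some else 0
    have hc : ∀ a ∈ M, c (projFiber H M a) ∈ projFiber H M a := fun a ha => by
      have h : (projFiber H M a).Nonempty := ⟨a, mem_projFiber_iff.2 ⟨ha, by simp⟩⟩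
      simpa only [c, dif_pos h] using h.some_mem
    refine ⟨fun a => c (projFiber H M a), fun a ha => (mem_projFiber_iff.1 (hc a ha)).1,
      fun a ha => ?_, fun a b h => by simp only [h]⟩
    simpa using H.neg_mem (mem_projFiber_iff.1 (hc a ha)).2
  have hρρ : ∀ a ∈ M, ρ (ρ a) = ρ a := fun a ha =>
    (hρ _ _ (projFiber_eq_of_sub_mem (hρH a ha))).symm
  let S : Set E := {a ∈ M | ρ a ≠ a}
  -- Roots are fixed by `ρ`, points of `S` are not.
  have hSne : ∀ a ∈ S, ∀ b ∈ S, a ≠ ρ b := fun a ha b hb h => ha.2 (by rw [h, hρρ b hb.1])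
  have hScard : ∀ A : Finset E, ↑A ⊆ S → A.card ≤ Module.finrank ℝ H := fun A hA =>
    hM.card_le_finrank hH (fun a ha => (hA ha).1) (fun a ha => hρM a (hA ha).1)
      (fun a ha b hb => hSne a (hA ha) b (hA hb)) (fun a ha => hρH a (hA ha).1)
  have hSfin : S.Finite := by
    by_contra hinf
    obtain ⟨A, hA, hcard⟩ := Set.Infinite.exists_subset_card_eq hinf (Module.finrank ℝ H + 1)
    have := hScard A hA
    omega
  have hSle : hSfin.toFinset.card ≤ Module.finrank ℝ H := hScard _ (by simp)
  -- A fiber consists of its chosen point and points of `S`.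
  have hfib : ∀ A ∈ M, projFiber H M A =
      insert (ρ A) {a | a ∈ hSfin.toFinset.filter fun a => projFiber H M a = projFiber H M A} := by
    intro A hA
    ext B
    simp only [Set.mem_insert_iff, Set.mem_ofPred_eq, Finset.mem_filter, Set.Finite.mem_toFinset]
    constructor
    · intro hB
      have hB' := mem_projFiber_iff.1 hB
      have hBA := projFiber_eq_of_sub_mem (M := M) hB'.2
      by_cases h : ρ B = B
      · exact Or.inl (by rw [← hρ _ _ hBA, h])
      · exact Or.inr ⟨⟨hB'.1, h⟩, hBA⟩
    · rintro (rfl | ⟨hB, hBA⟩)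
      · exact mem_projFiber_iff.2 ⟨hρM A hA, by simpa using H.neg_mem (hρH A hA)⟩
      · rw [← hBA]
        exact mem_projFiber_iff.2 ⟨hB.1, by simp⟩
  have hnd : ∀ F ∈ nondegenerateFibers H M, ∃ A ∈ S, F = projFiber H M A := by
    rintro F ⟨⟨A, hA, rfl⟩, hF⟩
    obtain ⟨B, hB, hBne⟩ := Set.exists_ne_of_one_lt_encard hF (ρ A)
    have hB' := mem_projFiber_iff.1 hB
    have hBA := projFiber_eq_of_sub_mem (M := M) hB'.2
    exact ⟨B, ⟨hB'.1, fun h => hBne (by rw [← hρ _ _ hBA, h])⟩, hBA.symm⟩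
  have hfin : (nondegenerateFibers H M).Finite :=
    (hSfin.image (projFiber H M)).subset fun F hF => by
      obtain ⟨A, hA, rfl⟩ := hnd F hF
      exact ⟨A, hA, rfl⟩
  have hncard : ∀ A ∈ M, (projFiber H M A).encard ≤
      ((hSfin.toFinset.filter fun a => projFiber H M a = projFiber H M A).card + 1 : ℕ) := by
    intro A hA
    refine (congrArg Set.encard (hfib A hA)).le.trans ((Set.encard_insert_le _ _).trans ?_)
    rw [Finset.setOfPred_mem, Set.encard_coe_eq_coe_finsetCard]
    simp
  refine ⟨hfin, ?_, ?_, ?_⟩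
  · rintro F ⟨⟨A, hA, rfl⟩, -⟩
    refine (hncard A hA).trans (Nat.cast_le.2 (Nat.succ_le_succ ?_))
    exact (Finset.card_filter_le _ _).trans hSle
  · rintro F ⟨⟨A, hA, rfl⟩, -⟩
    have hroot : ρ A ∈ projFiber H M A := by rw [hfib A hA]; exact Set.mem_insert _ _
    rw [affineIndependent_iff_linearIndependent_vsub ℝ _ (⟨ρ A, hroot⟩ : projFiber H M A)]
    have hli := hM.linearIndependent_finset (A := hSfin.toFinset) (ρ := ρ)
      (fun a ha => (hSfin.mem_toFinset.1 ha).1) (fun a ha => hρM a (hSfin.mem_toFinset.1 ha).1)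
      (fun a ha b hb => hSne a (hSfin.mem_toFinset.1 ha) b (hSfin.mem_toFinset.1 hb))
      ((Nat.cast_le.2 (hSle.trans (Nat.le_succ _))).trans (Submodule.finrank_add_one_le_rank hH))
    have hρx : ∀ x ∈ projFiber H M A, ρ x = ρ A := fun x hx =>
      hρ _ _ (projFiber_eq_of_sub_mem (mem_projFiber_iff.1 hx).2)
    have hxS : ∀ x : {x : projFiber H M A // x ≠ ⟨ρ A, hroot⟩}, (x : E) ∈ hSfin.toFinset := by
      rintro ⟨⟨x, hx⟩, hne⟩
      rw [hSfin.mem_toFinset]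
      refine ⟨(mem_projFiber_iff.1 hx).1, fun h => hne (Subtype.ext ?_)⟩
      rw [← h]
      exact hρx x hx
    have hcomp := hli.comp (fun x : {x : projFiber H M A // x ≠ ⟨ρ A, hroot⟩} => ⟨x, hxS x⟩)
      (fun x y h => Subtype.ext (Subtype.ext (Subtype.mk.inj h)))
    have heq : (fun x : {x : projFiber H M A // x ≠ ⟨ρ A, hroot⟩} => (x : E) -ᵥ ρ A) =
        (fun a : hSfin.toFinset => (a : E) - ρ a) ∘
          fun x : {x : projFiber H M A // x ≠ ⟨ρ A, hroot⟩} => ⟨x, hxS x⟩ := by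
      funext x
      simp [hρx x x.1.2]
    rw [← heq] at hcomp
    exact hcomp
  · refine le_trans ?_ hSle
    calc ∑ F ∈ hfin.toFinset, (F.ncard - 1)
        ≤ ∑ F ∈ hfin.toFinset, (hSfin.toFinset.filter fun a => projFiber H M a = F).card := by
          refine Finset.sum_le_sum fun F hF => ?_
          obtain ⟨⟨A, hA, rfl⟩, -⟩ := hfin.mem_toFinset.1 hF
          have h := ENat.toNat_le_toNat (hncard A hA) (ENat.natCast_ne_top _)
          rw [ENat.toNat_natCast] at h
          exact Nat.sub_le_iff_le_add.2 h
      _ ≤ hSfin.toFinset.card := by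
          rw [← Finset.card_biUnion]
          · exact Finset.card_le_card
              (Finset.biUnion_subset.2 fun F _ => Finset.filter_subset _ _)
          · intro F _ G _ hFG
            refine Finset.disjoint_left.2 fun a ha hb => hFG ?_
            rw [← (Finset.mem_filter.1 ha).2, (Finset.mem_filter.1 hb).2]

end StarIndependent

theorem InGeneralPositionWrtFiniteKernels.starIndependent {M : Set E}
    (hM : InGeneralPositionWrtFiniteKernels M) : StarIndependent M := by
  classical
  intro m hm a b ha hb hab
  by_contra hli
  let D : Submodule ℝ E := Submodule.span ℝ (Set.range fun i => a i - b i)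
  have hmem : ∀ i, a i - b i ∈ D := fun i => Submodule.subset_span ⟨i, rfl⟩
  have hD : FiniteDimensional ℝ D := FiniteDimensional.span_of_finite ℝ (Set.finite_range _)
  have hlt : Module.finrank ℝ D < m := by
    rw [linearIndependent_iff_card_le_finrank_span, not_le, Fintype.card_fin] at hli
    exact hli
  -- `finrank D < m` forces `m > 0`, so the index `0` exists.
  have hbot : D ≠ ⊥ := by
    intro h
    have hi := hmem ⟨0, by omega⟩
    rw [h, Submodule.mem_bot, sub_eq_zero] at hi
    exact hab.2 _ _ hi
  have htop : D ≠ ⊤ := by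
    intro h
    have hr : Module.rank ℝ E = Module.finrank ℝ D := by
      rw [Module.finrank_eq_rank, h, rank_top]
    rw [hr, Nat.cast_le] at hm
    omega
  have hgp := hM D hbot htop
  refine absurd hgp.excess_le (not_le.2 (hlt.trans_le ?_))
  have hmaps : ∀ i, projFiber D M (a i) ∈ nondegenerateFibers D M := fun i => by
    refine ⟨⟨a i, ha i, rfl⟩, Set.one_lt_encard_iff.2 ⟨a i, b i, ?_, ?_, hab.2 i i⟩⟩
    · exact mem_projFiber_iff.2 ⟨ha i, by simp⟩
    · exact mem_projFiber_iff.2 ⟨hb i, by simpa using D.neg_mem (hmem i)⟩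
  calc m = (Finset.univ : Finset (Fin m)).card := by simp
    _ = ∑ F ∈ hgp.finite_fibers.toFinset,
          (Finset.univ.filter fun i => projFiber D M (a i) = F).card :=
        Finset.card_eq_sum_card_fiberwise fun i _ => by simpa using hmaps i
    _ ≤ _ := by
        refine Finset.sum_le_sum fun F hF => ?_
        have hF' := hgp.finite_fibers.mem_toFinset.1 hF
        have hFfin : F.Finite := Set.finite_of_encard_le_coe (hgp.encard_le F hF')
        rcases (Finset.univ.filter fun i => projFiber D M (a i) = F).eq_empty_or_nonempty with
          h | ⟨i, hi⟩
        · simp [h]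
        have hi' := (Finset.mem_filter.1 hi).2
        have hbF : b i ∈ F := by
          rw [← hi']
          exact mem_projFiber_iff.2 ⟨hb i, by simpa using D.neg_mem (hmem i)⟩
        -- The `a j` lying in `F` avoid the point `b i` of `F`, which accounts for the `- 1` in the
        -- excess.
        have hainj : Function.Injective a := fun j l h => by
          by_contra hne
          exact hab.1 j l hne h
        rw [← Finset.card_image_of_injective _ hainj, ← Set.ncard_coe_finset,
          ← Set.ncard_sdiff_singleton_of_mem hbF]
        refine Set.ncard_le_ncard ?_ (hFfin.sdiff)
        intro x hx
        obtain ⟨j, hj, rfl⟩ := Finset.mem_image.1 hx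
        refine ⟨?_, hab.2 j i⟩
        rw [← (Finset.mem_filter.1 hj).2]
        exact mem_projFiber_iff.2 ⟨ha j, by simp⟩

theorem inGeneralPositionWrtFiniteKernels_iff {M : Set E} :
    InGeneralPositionWrtFiniteKernels M ↔ StarIndependent M :=
  ⟨fun h => h.starIndependent, fun h H _ _ hH => h.inGeneralPositionWrt H hH⟩

theorem inGeneralPositionWrtAll_iff [FiniteDimensional ℝ E] {M : Set E} :
    InGeneralPositionWrtAll M ↔ StarIndependent M := by
  rw [← inGeneralPositionWrtFiniteKernels_iff]
  exact ⟨fun h H _ h₁ h₂ => h H h₁ h₂, fun h H h₁ h₂ => h H h₁ h₂⟩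

end Equivalence

/-- A left inverse `P` of the combination map of `u` turns that of `v + t • u` into `A + t`, which
is injective unless `-t` is one of the finitely many eigenvalues of `A`. -/
theorem LinearIndependent.dense_setOf_add_smul {ι E : Type*} [Finite ι] [AddCommGroup E]
    [Module ℝ E] {u : ι → E} (hu : LinearIndependent ℝ u) (v : ι → E) :
    Dense {t : ℝ | LinearIndependent ℝ (v + t • u)} := by
  have := Fintype.ofFinite ι
  obtain ⟨P, hP⟩ := (Fintype.linearCombination ℝ u).exists_leftInverse_of_injective
    (LinearMap.ker_eq_bot.2 (linearIndependent_iff_injective_fintypeLinearCombination.1 hu))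
  let A : Module.End ℝ (ι → ℝ) := P ∘ₗ Fintype.linearCombination ℝ v
  have hfin : {t : ℝ | A.HasEigenvalue (-t)}.Finite :=
    A.finite_hasEigenvalue.preimage neg_injective.injOn
  refine hfin.countable.dense_compl ℝ |>.mono fun t ht => ?_
  have hker : LinearMap.ker (A - algebraMap ℝ (Module.End ℝ (ι → ℝ)) (-t)) = ⊥ := by
    by_contra h
    exact ht (Module.End.hasEigenvalue_iff.2 (by rwa [Module.End.eigenspace_def]))
  have hcomp : A - algebraMap ℝ (Module.End ℝ (ι → ℝ)) (-t) =
      P ∘ₗ Fintype.linearCombination ℝ (v + t • u) := by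
    have hlin : Fintype.linearCombination ℝ (v + t • u) =
        Fintype.linearCombination ℝ v + t • Fintype.linearCombination ℝ u := by
      refine LinearMap.ext fun c => ?_
      simp [Fintype.linearCombination_apply, Finset.sum_add_distrib, Finset.smul_sum,
        smul_comm t]
    rw [hlin, LinearMap.comp_add, LinearMap.comp_smul, hP, map_neg, sub_neg_eq_add]
    rfl
  rw [hcomp, LinearMap.ker_eq_bot, LinearMap.coe_comp] at hker
  exact linearIndependent_iff_injective_fintypeLinearCombination.2 hker.of_comp

/-! ### Generic maps from binary sequences -/

section Maps

variable {E : Type*} [NormedAddCommGroup E] [NormedSpace ℝ E]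

theorem isOpen_setOf_linearIndependent_sub {T : Type*} {m : ℕ} (a b : Fin m → T) :
    IsOpen {z : T → E | LinearIndependent ℝ fun i => z (a i) - z (b i)} :=
  (isOpen_setOfPred_linearIndependent (𝕜 := ℝ) (E := E) (ι := Fin m)).preimage (by fun_prop)

theorem dense_setOf_linearIndependent_sub {T : Type*} {m : ℕ}
    (hm : (m : Cardinal) ≤ Module.rank ℝ E) {a b : Fin m → T} (hab : Separated (· ≠ ·) a b) :
    Dense {z : T → E | LinearIndependent ℝ fun i => z (a i) - z (b i)} := by
  obtain ⟨u, hu⟩ := Module.le_rank_iff.1 hm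
  have hinj : Function.Injective a := fun i j h => by
    by_contra hne
    exact hab.1 i j hne h
  -- Moving `z` along `w` changes the `i`-th difference by a multiple of `u i`, since `w` vanishes
  -- at every `b i`.
  let w : T → E := Function.extend a u 0
  have hwa : ∀ i, w (a i) = u i := fun i => hinj.extend_apply u 0 i
  have hwb : ∀ i, w (b i) = 0 := fun i =>
    Function.extend_apply' u (0 : T → E) (b i) fun ⟨j, hj⟩ => hab.2 j i hj
  intro z
  have hcont : Continuous fun t : ℝ => z + t • w := by fun_prop
  have h0 := hu.dense_setOf_add_smul (fun i => z (a i) - z (b i)) 0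
  have hz := map_mem_closure hcont h0
    (t := {z : T → E | LinearIndependent ℝ fun i => z (a i) - z (b i)}) fun t ht => by
      have heq : (fun i => (z + t • w) (a i) - (z + t • w) (b i)) =
          (fun i => z (a i) - z (b i)) + t • u := by
        funext i
        simp only [Pi.add_apply, Pi.smul_apply, hwa, hwb]
        module
      change LinearIndependent ℝ (fun i => (z + t • w) (a i) - (z + t • w) (b i))
      rw [heq]
      exact ht
  simpa using hz

theorem dense_setOf_forall_linearIndependent_sub [CompleteSpace E] (T : Type*) [Finite T] {m : ℕ}
    (hm : (m : Cardinal) ≤ Module.rank ℝ E) :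
    Dense {z : T → E | ∀ a b : Fin m → T, Separated (· ≠ ·) a b →
      LinearIndependent ℝ fun i => z (a i) - z (b i)} := by
  have := Fintype.ofFinite T
  have h := dense_iInter_of_isOpen
    (ι := {p : (Fin m → T) × (Fin m → T) // Separated (· ≠ ·) p.1 p.2})
    (fun p => isOpen_setOf_linearIndependent_sub (E := E) p.1.1 p.1.2)
    (fun p => dense_setOf_linearIndependent_sub hm p.2)
  exact h.mono fun z hz a b hab => Set.mem_iInter.1 hz ⟨(a, b), hab⟩

/-- The first `l` terms of a binary sequence. -/
def truncate (l : ℕ) (x : ℕ → Bool) : Fin l → Bool := fun i => x i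

theorem continuous_truncate (l : ℕ) : Continuous (truncate l) := by
  unfold truncate
  fun_prop

theorem truncate_eq_of_le {l l' : ℕ} (h : l ≤ l') {x y : ℕ → Bool}
    (hxy : truncate l' x = truncate l' y) : truncate l x = truncate l y :=
  funext fun i => congrFun hxy (i.castLE h)

theorem eventually_truncate_ne {x y : ℕ → Bool} (h : x ≠ y) :
    ∀ᶠ l in Filter.atTop, truncate l x ≠ truncate l y := by
  obtain ⟨n, hn⟩ := Function.ne_iff.1 h
  filter_upwards [Filter.eventually_gt_atTop n] with l hl hxy
  exact hn (congrFun hxy ⟨n, hl⟩)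

theorem eventually_separated_truncate {m : ℕ} {a b : Fin m → ℕ → Bool}
    (hab : Separated (· ≠ ·) a b) :
    ∀ᶠ l in Filter.atTop, Separated (· ≠ ·) (truncate l ∘ a) (truncate l ∘ b) := by
  refine Filter.Eventually.and ?_ ?_
  · simp only [Filter.eventually_all]
    exact fun i j hij => eventually_truncate_ne (hab.1 i j hij)
  · simp only [Filter.eventually_all]
    exact fun i j => eventually_truncate_ne (hab.2 i j)

/-- A continuous function on binary sequences almost depends on finitely many terms only. -/
theorem ContinuousMap.exists_truncate_dist_lt {X : Type*} [PseudoMetricSpace X]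
    (φ : C(ℕ → Bool, X)) {ε : ℝ} (hε : 0 < ε) :
    ∃ l, ∀ x y, truncate l x = truncate l y → dist (φ x) (φ y) < ε := by
  by_contra! h
  let Z : ℕ → Set ((ℕ → Bool) × (ℕ → Bool)) := fun l =>
    {p | truncate l p.1 = truncate l p.2} ∩ {p | ε ≤ dist (φ p.1) (φ p.2)}
  have hclosed : ∀ l, IsClosed (Z l) := fun l =>
    (isClosed_eq ((continuous_truncate l).comp continuous_fst)
      ((continuous_truncate l).comp continuous_snd)).inter
      (isClosed_le continuous_const (by fun_prop))
  -- A pair in all `Z l` agrees in every term, yet its images are at least `ε` apart.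
  obtain ⟨⟨x, y⟩, hxy⟩ := IsCompact.nonempty_iInter_of_sequence_nonempty_isCompact_isClosed Z
    (fun l p hp => ⟨truncate_eq_of_le (Nat.le_succ l) hp.1, hp.2⟩)
    (fun l => by
      obtain ⟨x, y, hxy, hd⟩ := h l
      exact ⟨(x, y), hxy, hd⟩)
    (hclosed 0).isCompact hclosed
  have hmem : ∀ l, (x, y) ∈ Z l := fun l => Set.mem_iInter.1 hxy l
  have hEq : x = y := funext fun n => congrFun (hmem (n + 1)).1 (Fin.last n)
  have hd : ε ≤ dist (φ x) (φ y) := (hmem 0).2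
  rw [hEq, dist_self] at hd
  exact hd.not_gt hε

/-- The maps whose values at `m + m` sequences, separated by their first `l` terms, have linearly
independent differences. -/
def independentMaps (E : Type*) [NormedAddCommGroup E] [NormedSpace ℝ E] (m l : ℕ) :
    Set C(ℕ → Bool, E) :=
  {φ | ∀ a b : Fin m → ℕ → Bool, Separated (· ≠ ·) (truncate l ∘ a) (truncate l ∘ b) →
    LinearIndependent ℝ fun i => φ (a i) - φ (b i)}

/-- Tuples separated by their first `l` terms form a compact set, and independence is open jointly
in the map and the tuple. -/
theorem isOpen_independentMaps (m l : ℕ) : IsOpen (independentMaps E m l) := by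
  let C : Set ((Fin m → ℕ → Bool) × (Fin m → ℕ → Bool)) :=
    {p | Separated (· ≠ ·) (truncate l ∘ p.1) (truncate l ∘ p.2)}
  have hC : IsCompact C := by
    have hcont : Continuous fun p : (Fin m → ℕ → Bool) × (Fin m → ℕ → Bool) =>
        ((fun i => truncate l (p.1 i), fun i => truncate l (p.2 i)) :
          (Fin m → Fin l → Bool) × (Fin m → Fin l → Bool)) := by
      have := continuous_truncate l
      fun_prop
    exact ((isClosed_discrete {q : (Fin m → Fin l → Bool) × (Fin m → Fin l → Bool) |
      Separated (· ≠ ·) q.1 q.2}).preimage hcont).isCompact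
  rw [isOpen_iff_mem_nhds]
  intro φ hφ
  have hcont : Continuous fun q : C(ℕ → Bool, E) × ((Fin m → ℕ → Bool) × (Fin m → ℕ → Bool)) =>
      fun i => q.1 (q.2.1 i) - q.1 (q.2.2 i) := by fun_prop
  have hev := hC.eventually_forall_of_forall_eventually (x₀ := φ)
    (P := fun φ p => LinearIndependent ℝ fun i => φ (p.1 i) - φ (p.2 i))
    fun p hp => (hcont.tendsto (φ, p)).eventually
      (p := fun f => LinearIndependent ℝ f) (hφ p.1 p.2 hp).eventually
  filter_upwards [hev] with ψ hψ a b hab using hψ (a, b) hab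

/-- Approximate `φ` by a map of the first `n` terms and perturb its finitely many values. As `n ≥
l`, separated sequences get distinct truncations. -/
theorem dense_independentMaps [CompleteSpace E] {m : ℕ} (hm : (m : Cardinal) ≤ Module.rank ℝ E)
    (l : ℕ) : Dense (independentMaps E m l) := by
  refine Metric.dense_iff.2 fun φ ε hε => ?_
  obtain ⟨l₀, hl₀⟩ := φ.exists_truncate_dist_lt (half_pos hε)
  let n := max l l₀
  let s : (Fin n → Bool) → ℕ → Bool := fun t i => if h : i < n then t ⟨i, h⟩ else false
  have hs : ∀ x, truncate n (s (truncate n x)) = truncate n x := fun x =>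
    funext fun i => by simp [s, truncate]
  obtain ⟨z, hz, hzball⟩ := (dense_setOf_forall_linearIndependent_sub (E := E) (Fin n → Bool)
    hm).exists_dist_lt (φ ∘ s) (half_pos hε)
  refine ⟨⟨fun x => z (truncate n x), (continuous_of_discreteTopology).comp
    (continuous_truncate n)⟩, ?_, ?_⟩
  · rw [Metric.mem_ball, ContinuousMap.dist_lt_iff hε]
    intro x
    have h₁ : dist (z (truncate n x)) (φ (s (truncate n x))) < ε / 2 := by
      rw [dist_comm]
      exact (dist_le_pi_dist (φ ∘ s) z (truncate n x)).trans_lt hzball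
    have h₂ := hl₀ (s (truncate n x)) x (truncate_eq_of_le (le_max_right l l₀) (hs x))
    calc dist (z (truncate n x)) (φ x) ≤ _ := dist_triangle _ (φ (s (truncate n x))) _
      _ < ε := by linarith
  · intro a b hab
    refine hz (fun i => truncate n (a i)) (fun i => truncate n (b i)) ⟨fun i j hij h => ?_,
      fun i j h => ?_⟩
    · exact hab.1 i j hij (truncate_eq_of_le (le_max_left l l₀) h)
    · exact hab.2 i j (truncate_eq_of_le (le_max_left l l₀) h)

theorem dense_setOf_injective_starIndependent_range [CompleteSpace E] [Nontrivial E] :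
    Dense {φ : C(ℕ → Bool, E) | Function.Injective φ ∧ StarIndependent (Set.range φ)} := by
  have h := dense_iInter_of_isOpen
    (ι := {m : ℕ // (m : Cardinal) ≤ Module.rank ℝ E} × ℕ)
    (fun p => isOpen_independentMaps (E := E) p.1 p.2)
    (fun p => dense_independentMaps p.1.2 p.2)
  refine h.mono fun φ hφ => ?_
  have key : ∀ m : ℕ, (m : Cardinal) ≤ Module.rank ℝ E → ∀ a b : Fin m → ℕ → Bool,
      Separated (· ≠ ·) a b → LinearIndependent ℝ fun i => φ (a i) - φ (b i) := by
    intro m hm a b hab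
    obtain ⟨l, hl⟩ := (eventually_separated_truncate hab).exists
    exact Set.mem_iInter.1 hφ (⟨m, hm⟩, l) a b hl
  constructor
  · intro x y hxy
    by_contra hne
    -- Injectivity is the case `m = 1`: a single independent difference is non-zero.
    have hone : ((1 : ℕ) : Cardinal) ≤ Module.rank ℝ E := by
      rw [Nat.cast_one, Cardinal.one_le_iff_pos]
      exact rank_pos
    have hli := key 1 hone (fun _ => x) (fun _ => y)
      ⟨fun i j hij => absurd (Subsingleton.elim i j) hij, fun _ _ => hne⟩
    exact hli.ne_zero 0 (sub_eq_zero.2 hxy)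
  · intro m hm a b ha hb hab
    choose a' ha' using ha
    choose b' hb' using hb
    have hli := key m hm a' b' ⟨fun i j hij h => hab.1 i j hij (by rw [← ha' i, ← ha' j, h]),
      fun i j h => hab.2 i j (by rw [← ha' i, ← hb' j, h])⟩
    simpa only [ha', hb'] using hli

end Maps

/-! ### The hyperspace of Cantor sets -/

section Hyperspace

variable {E : Type*} [NormedAddCommGroup E] [NormedSpace ℝ E]

/-- The tuples from `K` form a compact subset of `S`, so a `δ`-thickening stays in `S`; it contains
all tuples from any `L` within Hausdorff distance `δ`. -/
theorem isOpen_setOf_forall_mem_nonemptyCompacts {ι X : Type*} [Finite ι] [MetricSpace X]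
    {S : Set (ι → X)} (hS : IsOpen S) :
    IsOpen {K : NonemptyCompacts X | ∀ x : ι → X, (∀ i, x i ∈ K) → x ∈ S} := by
  have := Fintype.ofFinite ι
  refine Metric.isOpen_iff.2 fun K hK => ?_
  obtain ⟨δ, hδ, hsub⟩ := (isCompact_univ_pi fun _ : ι => K.isCompact).exists_thickening_subset_open
    hS fun x hx => hK x fun i => hx i trivial
  refine ⟨δ, hδ, fun L hL x hx => hsub (Metric.mem_thickening_iff.2 ?_)⟩
  rw [Metric.mem_ball, Metric.NonemptyCompacts.dist_eq] at hL
  have hne : Metric.hausdorffEDist (L : Set X) (K : Set X) ≠ ⊤ :=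
    Metric.hausdorffEDist_ne_top_of_nonempty_of_bounded L.nonempty K.nonempty
      L.isCompact.isBounded K.isCompact.isBounded
  choose y hy hxy using fun i => Metric.exists_dist_lt_of_hausdorffDist_lt (hx i) hL hne
  exact ⟨y, fun i _ => hy i, (dist_pi_lt_iff hδ).2 hxy⟩

theorem isGδ_setOf_starIndependent :
    IsGδ {K : NonemptyCompacts E | StarIndependent (K : Set E)} := by
  -- Distinctness is not a closed condition; distance at least `1 / (q + 1)` is, which makes each
  -- implication `S m q` open.
  let far (q : ℕ) (x y : E) : Prop := 1 / ((q : ℝ) + 1) ≤ dist x y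
  let S (m q : ℕ) : Set (Fin m ⊕ Fin m → E) :=
    {x | Separated (far q) (x ∘ Sum.inl) (x ∘ Sum.inr) →
      LinearIndependent ℝ fun i => x (Sum.inl i) - x (Sum.inr i)}
  have hfar : ∀ q m (i j : Fin m ⊕ Fin m), IsClosed {x : Fin m ⊕ Fin m → E | far q (x i) (x j)} :=
    fun q m i j => isClosed_le continuous_const (by fun_prop)
  have hSopen : ∀ m q, IsOpen (S m q) := by
    intro m q
    have hclosed : IsClosed {x : Fin m ⊕ Fin m → E |
        Separated (far q) (x ∘ Sum.inl) (x ∘ Sum.inr)} := by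
      simp only [Separated, Set.ofPred_and, Set.ofPred_forall]
      exact (isClosed_iInter fun i => isClosed_iInter fun j => isClosed_iInter fun _ =>
        hfar q m _ _).inter (isClosed_iInter fun i => isClosed_iInter fun j => hfar q m _ _)
    have hopen := isOpen_setOf_linearIndependent_sub (E := E)
      (Sum.inl : Fin m → Fin m ⊕ Fin m) Sum.inr
    convert! hclosed.isOpen_compl.union hopen using 1
    ext x
    exact imp_iff_not_or
  have hset : {K : NonemptyCompacts E | StarIndependent (K : Set E)} =
      ⋂ p : {m : ℕ // (m : Cardinal) ≤ Module.rank ℝ E} × ℕ,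
        {K : NonemptyCompacts E | ∀ x : Fin p.1.1 ⊕ Fin p.1.1 → E, (∀ i, x i ∈ K) →
          x ∈ S p.1 p.2} := by
    ext K
    simp only [Set.mem_iInter]
    constructor
    · rintro hK ⟨⟨m, hm⟩, q⟩ x hx hsep
      have hpos : (0 : ℝ) < 1 / ((q : ℝ) + 1) := by positivity
      have hne : ∀ {u v : E}, far q u v → u ≠ v := fun h => dist_pos.1 (hpos.trans_le h)
      exact hK m hm (x ∘ Sum.inl) (x ∘ Sum.inr) (fun i => hx _) (fun i => hx _)
        ⟨fun i j hij => hne (hsep.1 i j hij), fun i j => hne (hsep.2 i j)⟩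
    · intro hK m hm a b ha hb hab
      have hev : ∀ {u v : E}, u ≠ v → ∀ᶠ q in Filter.atTop, far q u v := fun h =>
        (tendsto_one_div_add_atTop_nhds_zero_nat.eventually_lt_const (dist_pos.2 h)).mono
          fun q hq => hq.le
      have hsep : ∀ᶠ q in Filter.atTop, Separated (far q) a b := by
        refine Filter.Eventually.and ?_ ?_
        · simp only [Filter.eventually_all]
          exact fun i j hij => hev (hab.1 i j hij)
        · simp only [Filter.eventually_all]
          exact fun i j => hev (hab.2 i j)
      obtain ⟨q, hq⟩ := hsep.exists
      exact hK (⟨m, hm⟩, q) (Sum.elim a b) (by rintro (i | i) <;> [exact ha i; exact hb i]) hq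
  rw [hset]
  exact .iInter fun p => (isOpen_setOf_forall_mem_nonemptyCompacts (hSopen _ _)).isGδ

theorem isGδ_setOf_starIndependent_cantorHyperspace :
    IsGδ {K : CantorHyperspace E | StarIndependent (K.1 : Set E)} :=
  isGδ_setOf_starIndependent.preimage continuous_subtype_val

theorem isCantorSet_range {X : Type*} [TopologicalSpace X] [T2Space X] {φ : C(ℕ → Bool, X)}
    (hφ : Function.Injective φ) :
    IsCantorSet (Set.range φ) :=
  ⟨(φ.continuous.isClosedEmbedding hφ).isEmbedding.toHomeomorph.symm.trans
    cantorSetHomeomorphNatToBool.symm⟩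

/-- Uniformly close parametrizations have Hausdorff-close images. -/
theorem dense_setOf_starIndependent_cantorHyperspace [CompleteSpace E] [Nontrivial E] :
    Dense {K : CantorHyperspace E | StarIndependent (K.1 : Set E)} := by
  refine Metric.dense_iff.2 fun ⟨K, ⟨h⟩⟩ ε hε => ?_
  let e : (ℕ → Bool) ≃ₜ K := (h.trans cantorSetHomeomorphNatToBool).symm
  let φ : C(ℕ → Bool, E) := ⟨fun x => e x, continuous_subtype_val.comp e.continuous⟩
  obtain ⟨ψ, ⟨hinj, hstar⟩, hdist⟩ :=
    dense_setOf_injective_starIndependent_range.exists_dist_lt φ (half_pos hε)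
  let L : NonemptyCompacts E :=
    ⟨⟨Set.range ψ, isCompact_range ψ.continuous⟩, Set.range_nonempty ψ⟩
  refine ⟨⟨L, isCantorSet_range hinj⟩, ?_, hstar⟩
  rw [Metric.mem_ball, Subtype.dist_eq, Metric.NonemptyCompacts.dist_eq]
  refine (Metric.hausdorffDist_le_of_mem_dist (half_pos hε).le ?_ ?_).trans_lt (half_lt_self hε)
  · rintro _ ⟨x, rfl⟩
    rw [dist_comm] at hdist
    exact ⟨φ x, (e x).2, (ContinuousMap.dist_apply_le_dist x).trans hdist.le⟩
  · intro y hy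
    refine ⟨ψ (e.symm ⟨y, hy⟩), ⟨_, rfl⟩, ?_⟩
    have hy' : φ (e.symm ⟨y, hy⟩) = y := congrArg Subtype.val (e.apply_symm_apply ⟨y, hy⟩)
    calc dist y (ψ (e.symm ⟨y, hy⟩)) = dist (φ (e.symm ⟨y, hy⟩)) (ψ (e.symm ⟨y, hy⟩)) := by
          rw [hy']
      _ ≤ ε / 2 := (ContinuousMap.dist_apply_le_dist _).trans hdist.le

end Hyperspace

theorem mainTheorem1 :
    (∀ N : ℕ, 2 ≤ N →
      IsGδ {K : CantorHyperspace (EuclideanSpace ℝ (Fin N)) |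
        InGeneralPositionWrtAll (K.1 : Set (EuclideanSpace ℝ (Fin N)))} ∧
      Dense {K : CantorHyperspace (EuclideanSpace ℝ (Fin N)) |
        InGeneralPositionWrtAll (K.1 : Set (EuclideanSpace ℝ (Fin N)))}) ∧
    (IsGδ {K : CantorHyperspace (lp (fun _ : ℕ => ℝ) 2) |
        InGeneralPositionWrtFiniteKernels (K.1 : Set (lp (fun _ : ℕ => ℝ) 2))} ∧
      Dense {K : CantorHyperspace (lp (fun _ : ℕ => ℝ) 2) |
        InGeneralPositionWrtFiniteKernels (K.1 : Set (lp (fun _ : ℕ => ℝ) 2))}) := by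
  simp only [inGeneralPositionWrtAll_iff, inGeneralPositionWrtFiniteKernels_iff]
  refine ⟨fun N hN => ?_, ?_⟩
  · have : Nonempty (Fin N) := ⟨⟨0, by omega⟩⟩
    exact ⟨isGδ_setOf_starIndependent_cantorHyperspace,
      dense_setOf_starIndependent_cantorHyperspace⟩
  · have : Nontrivial (lp (fun _ : ℕ => ℝ) 2) := by
      refine ⟨lp.single 2 0 1, 0, fun h => ?_⟩
      have h0 := congrArg (fun f : lp (fun _ : ℕ => ℝ) 2 => f 0) h
      simp at h0
    exact ⟨isGδ_setOf_starIndependent_cantorHyperspace,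
      dense_setOf_starIndependent_cantorHyperspace⟩
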